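/- Let $m,n\ge 0$ and $r\ge 1$ be integers, let $M$ be a fixed nonzero real $m\times n$ matrix, and let $\mu,\sigma\in\mathbb R$ with $\sigma>0$. Let $G'$ be a random $r\times m$ matrix and $H'$ a random $n\times r$ matrix, each filled with independent Gaussian entries of mean $\mu$ and variance $\sigma^2$ (no relation between $G'$ and $H'$ is assumed). Let $U\in\mathbb R^{r\times m}$ and $V\in\mathbb R^{n\times r}$ be arbitrary fixed matrices, and put $G=G'+U$, $H=H'+V$ and $\widehat r=\min\{r,\operatorname{rank} M\}$. Write $\|\cdot\|$ for the spectral norm, $A^+$ for the Moore--Penrose pseudo-inverse of $A$, and $\sigma_{\min}(A)$ for the smallest positive singular value of $A\ne 0$, which equals $1/\|A^+\|$. For $A=0$ put $1/\|A^+\|=\sigma_{\min}(A)=0$. Then for both $P=GM$ and $P=MH$: 1. for every $y\ge 0$, $$\Pr\Big\{\frac1{\|P^+\|}\le y\Big\}\le \frac{2.35\,y\sqrt{\widehat r}\,\|M^+\|}{\sigma}\quad\text{and}\quad \Pr\{\sigma_{\min}(P)\le y\}\le \frac{2.35\,y\sqrt{\widehat r}\,\|M^+\|}{\sigma};$$ 2.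 for every $x>0$, $$\Pr\Big\{\|P^+\|\ge \frac{2.35\,x\sqrt{\widehat r}\,\|M^+\|}{\sigma}\Big\}\le \frac1x .$$ -/

import Mathlib

open MeasureTheory ProbabilityTheory
open scoped Matrix Matrix.Norms.L2Operator

/-- `X` is a Moore–Penrose pseudo-inverse of the real matrix `A` (the four Penrose equations). -/
structure IsMoorePenrose {m n : ℕ} (A : Matrix (Fin m) (Fin n) ℝ)
    (X : Matrix (Fin n) (Fin m) ℝ) : Prop where
  mul_mul_self : A * X * A = A
  self_mul_mul : X * A * X = X
  symm_left : (A * X)ᵀ = A * X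
  symm_right : (X * A)ᵀ = X * A

theorem IsMoorePenrose.unique {m n : ℕ} {A : Matrix (Fin m) (Fin n) ℝ}
    {X Y : Matrix (Fin n) (Fin m) ℝ} (hX : IsMoorePenrose A X) (hY : IsMoorePenrose A Y) :
    X = Y := by
  have h1 : A * X = A * Y := by
    calc A * X = (A * X)ᵀ := hX.symm_left.symm
      _ = ((A * Y) * (A * X))ᵀ := by rw [← Matrix.mul_assoc, hY.mul_mul_self]
      _ = (A * X) * (A * Y) := by rw [Matrix.transpose_mul, hX.symm_left, hY.symm_left]
      _ = A * Y := by rw [← Matrix.mul_assoc, hX.mul_mul_self]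
  have h2 : X * A = Y * A := by
    calc X * A = (X * A)ᵀ := hX.symm_right.symm
      _ = ((X * A) * (Y * A))ᵀ := by
          rw [Matrix.mul_assoc, ← Matrix.mul_assoc A, hY.mul_mul_self]
      _ = (Y * A) * (X * A) := by rw [Matrix.transpose_mul, hX.symm_right, hY.symm_right]
      _ = Y * A := by rw [Matrix.mul_assoc, ← Matrix.mul_assoc A, hX.mul_mul_self]
  calc X = X * A * X := hX.self_mul_mul.symm
    _ = Y * A * Y := by rw [h2, Matrix.mul_assoc, h1, ← Matrix.mul_assoc]
    _ = Y := hY.self_mul_mul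

theorem exists_isMoorePenrose {m n : ℕ} (A : Matrix (Fin m) (Fin n) ℝ) :
    ∃ X, IsMoorePenrose A X := by
  have hB : (Aᵀ * A).IsHermitian := by
    simpa using Matrix.isHermitian_conjTranspose_mul_self A
  obtain ⟨U, d, hU, hs⟩ : ∃ (U : Matrix (Fin n) (Fin n) ℝ) (d : Fin n → ℝ),
      Uᵀ * U = 1 ∧ Aᵀ * A = U * Matrix.diagonal d * Uᵀ := by
    refine ⟨hB.eigenvectorUnitary, hB.eigenvalues, ?_, ?_⟩
    · have := (Matrix.mem_unitaryGroup_iff' (n := Fin n) (α := ℝ)).1 hB.eigenvectorUnitary.2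
      simpa [Matrix.star_eq_conjTranspose] using this
    · have := hB.spectral_theorem
      simpa [Unitary.conjStarAlgAut_apply, Matrix.star_eq_conjTranspose, Function.comp_def]
        using this
  set D := Matrix.diagonal d with hD
  set I := Matrix.diagonal (fun i => (d i)⁻¹) with hI
  have hID : I * D = D * I := by simp [hD, hI, mul_comm]
  have hIDI : I * (D * I) = I := by
    simp only [hD, hI, Matrix.diagonal_mul_diagonal]
    congr 1; ext i
    by_cases h : d i = 0 <;> simp [h]
  have hDID : D * (I * D) = D := by
    simp only [hD, hI, Matrix.diagonal_mul_diagonal]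
    congr 1; ext i
    by_cases h : d i = 0 <;> simp [h]
  have hIt : Iᵀ = I := by simp [hI]
  have hDt : Dᵀ = D := by simp [hD]
  have hUU : ∀ Z : Matrix (Fin n) (Fin n) ℝ, Uᵀ * (U * Z) = Z := fun Z => by
    rw [← Matrix.mul_assoc, hU, Matrix.one_mul]
  set X := U * I * Uᵀ * Aᵀ with hX
  have hXA : X * A = U * (D * I) * Uᵀ := by
    rw [hX, Matrix.mul_assoc _ Aᵀ A, hs]
    simp only [Matrix.mul_assoc, hUU]
    rw [← Matrix.mul_assoc I D, hID, Matrix.mul_assoc]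
  have hsymm : (X * A)ᵀ = X * A := by
    rw [hXA]
    simp only [Matrix.transpose_mul, Matrix.transpose_transpose, hIt, hDt, hID, Matrix.mul_assoc]
  have hBE : Aᵀ * A * (X * A) = Aᵀ * A := by
    rw [hXA, hs]
    simp only [Matrix.mul_assoc, hUU]
    rw [← Matrix.mul_assoc D I, ← hID, ← Matrix.mul_assoc D (I * D), hDID]
  refine ⟨X, ?_, ?_, ?_, hsymm⟩
  · have h0 : (A * X * A - A)ᴴ * (A * X * A - A) = 0 := by
      rw [Matrix.conjTranspose_eq_transpose_of_trivial]
      have h1 : A * X * A - A = A * (X * A - 1) := by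
        rw [Matrix.mul_sub, Matrix.mul_one, Matrix.mul_assoc]
      rw [h1, Matrix.transpose_mul, Matrix.mul_assoc, ← Matrix.mul_assoc Aᵀ A,
        Matrix.mul_sub (Aᵀ * A), hBE, Matrix.mul_one, sub_self, Matrix.mul_zero]
    exact sub_eq_zero.1 (Matrix.conjTranspose_mul_self_eq_zero.1 h0)
  · rw [hXA, hX]
    have : U * (D * I) * Uᵀ * (U * I * Uᵀ * Aᵀ) = U * (I * (D * I)) * Uᵀ * Aᵀ := by
      have h2 : ∀ Z : Matrix (Fin n) (Fin m) ℝ, Uᵀ * (U * Z) = Z := fun Z => by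
        rw [← Matrix.mul_assoc, hU, Matrix.one_mul]
      simp only [Matrix.mul_assoc, h2]
      rw [← Matrix.mul_assoc D I, ← hID, Matrix.mul_assoc]
    rw [this, hIDI]
  · rw [hX]
    simp only [Matrix.transpose_mul, Matrix.transpose_transpose, hIt, Matrix.mul_assoc]

/-- The Moore–Penrose pseudo-inverse `A⁺` of a real matrix `A`. -/
noncomputable def pinv {m n : ℕ} (A : Matrix (Fin m) (Fin n) ℝ) : Matrix (Fin n) (Fin m) ℝ :=
  (exists_isMoorePenrose A).choose

theorem pinv_spec {m n : ℕ} (A : Matrix (Fin m) (Fin n) ℝ) : IsMoorePenrose A (pinv A) :=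
  (exists_isMoorePenrose A).choose_spec

/-- The smallest positive singular value `σ_ρ(A)` of a matrix `A` of rank `ρ ≥ 1`. Mathlib lists the
singular values in decreasing order starting from index `0`, so `σ_ρ` has index `ρ - 1`.
(For `A = 0` the value is `0`.) -/
noncomputable def sigmaMin {m n : ℕ} (A : Matrix (Fin m) (Fin n) ℝ) : ℝ :=
  (Matrix.toEuclideanLin A).singularValues (A.rank - 1)

/-- `X` is a Gaussian random matrix with mean `a` and variance `σ ^ 2` on the probability space
`(Ω, P)`: its entries are independent, each with the normal law of that mean and variance. -/
structure IsGaussianMatrix {Ω : Type*} [MeasurableSpace Ω] (P : Measure Ω) {k l : ℕ} (a σ : ℝ)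
    (X : Ω → Matrix (Fin k) (Fin l) ℝ) : Prop where
  hasLaw : ∀ i j, HasLaw (fun ω => X ω i j) (gaussianReal a (σ ^ 2).toNNReal) P
  indep : iIndepFun (fun (p : Fin k × Fin l) ω => X ω p.1 p.2) P

/-! Put `k = min r M.rank` and keep `k` rows of `GM`, forming `A`. If `‖Aᵀu‖ > y` for every unit
`u`, then `A` has rank `k`, `y * ‖A⁺‖ < 1`, and the rows of `A` span the row space of `GM`, so
`‖(GM)⁺‖ ≤ ‖A⁺‖`. Hence the bad event forces a unit `u` with `‖MᵀZᵀu‖ ≤ y`, where `Z` is the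
corresponding `k × m` Gaussian block.

The vector `u` depends on `Z`, so it is compared with an independent standard Gaussian `v` in `ℝᵏ`.
Given `u`, the event `|⟨u, v⟩| ≥ 3/4` has probability bounded below. For fixed `v`, rescale `u` to
have inner product 1 with `v/‖v‖`: then `uᵀZ` is the Gaussian row `g` along `v/‖v‖` plus a term
independent of `g`, whose image under `Mᵀ` stays in a space of dimension below `k ≤ rank M`.
Projecting onto a unit normal of that space in the range of `Mᵀ` leaves one Gaussian of standard
deviation at least `σ/‖M⁺‖`, which lies in a short interval with small probability
(`stdGaussian_exists_inner_eq_one_le`). Fubini and `E‖v‖ ≤ √k` give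
`stdGaussian_exists_norm_rowComb_le`. Right products follow by transposition. -/

/-! ### Scalar Gaussian estimates -/

theorem stdGaussian_map_inner {E : Type*} [NormedAddCommGroup E] [InnerProductSpace ℝ E]
    [FiniteDimensional ℝ E] [MeasurableSpace E] [BorelSpace E] (w : E) :
    (stdGaussian E).map (fun z => inner ℝ w z) = gaussianReal 0 (‖w‖ ^ 2).toNNReal := by
  have h := IsGaussian.map_eq_gaussianReal (μ := stdGaussian E) (innerSL ℝ w)
  rw [integral_strongDual_stdGaussian, variance_dual_stdGaussian] at h
  simpa using h

/-- The density is at most `1/(√(2π) s)` and the interval has length `2t`. -/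
theorem gaussianReal_abs_add_le (c t : ℝ) {s : ℝ} (hs : 0 < s) :
    gaussianReal 0 (s ^ 2).toNNReal {x | |c + x| ≤ t} ≤
      ENNReal.ofReal (√(2 / Real.pi) * t / s) := by
  have hv : (s ^ 2).toNNReal ≠ 0 := by simp; positivity
  rw [gaussianReal_apply _ hv]
  have hset : {x : ℝ | |c + x| ≤ t} = Set.Icc (-t - c) (t - c) := by
    ext x; simp only [Set.mem_ofPred_eq, abs_le, Set.mem_Icc]
    constructor <;> rintro ⟨h1, h2⟩ <;> constructor <;> linarith
  rw [hset]
  calc _ ≤ ∫⁻ x in Set.Icc (-t - c) (t - c), ENNReal.ofReal ((√(2 * Real.pi) * s)⁻¹) := by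
        refine lintegral_mono fun x => ENNReal.ofReal_le_ofReal ?_
        rw [gaussianPDFReal, Real.coe_toNNReal _ (sq_nonneg s), Real.sqrt_mul (by positivity),
          Real.sqrt_sq hs.le]
        refine mul_le_of_le_one_right (by positivity) (Real.exp_le_one_iff.2 ?_)
        exact div_nonpos_of_nonpos_of_nonneg (by simpa using sq_nonneg x) (by positivity)
    _ = _ := by
        rw [setLIntegral_const, Real.volume_Icc, ← ENNReal.ofReal_mul (by positivity)]
        congr 1
        have h2 : √(2 / Real.pi) * √(2 * Real.pi) = 2 := by
          rw [← Real.sqrt_mul (by positivity)]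
          rw [show 2 / Real.pi * (2 * Real.pi) = 2 ^ 2 by field_simp]
          exact Real.sqrt_sq (by norm_num)
        have h3 : 0 < √(2 * Real.pi) := by positivity
        field_simp
        linear_combination (-t) * h2

theorem stdGaussian_abs_add_inner_le {E : Type*} [NormedAddCommGroup E] [InnerProductSpace ℝ E]
    [FiniteDimensional ℝ E] [MeasurableSpace E] [BorelSpace E] {w : E} (hw : w ≠ 0) (c t : ℝ) :
    stdGaussian E {z | |c + inner ℝ w z| ≤ t} ≤ ENNReal.ofReal (√(2 / Real.pi) * t / ‖w‖) := by
  refine le_trans (le_of_eq ?_) (gaussianReal_abs_add_le c t (norm_pos_iff.2 hw))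
  rw [← stdGaussian_map_inner, Measure.map_apply (by fun_prop)
    (measurableSet_le (by fun_prop) measurable_const)]
  rfl

/-- Because `(1 + x + x²/2)(1 - x + x²/2) = 1 + x⁴/4 ≥ 1`. -/
theorem Real.exp_neg_le_quadratic {x : ℝ} (hx : 0 ≤ x) : Real.exp (-x) ≤ 1 - x + x ^ 2 / 2 := by
  have h1 : 1 + x + x ^ 2 / 2 ≤ Real.exp x := Real.quadratic_le_exp_of_nonneg hx
  rw [Real.exp_neg]
  refine (inv_anti₀ (by positivity) h1).trans ?_
  rw [inv_le_iff_one_le_mul₀ (by positivity)]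
  nlinarith [pow_nonneg hx 4]

/-- The number 0.685621 is the integral of `1 - x²/2 + x⁴/8` over `[0, 3/4]`, rounded up. -/
theorem gaussianReal_abs_lt_le :
    gaussianReal 0 1 {x : ℝ | |x| < 3 / 4} ≤ ENNReal.ofReal (√(2 / Real.pi) * 0.685621) := by
  have hset : {x : ℝ | |x| < 3 / 4} ⊆ Set.Ioc (-(3 / 4)) (3 / 4) := fun x hx => by
    simp only [Set.mem_ofPred_eq, abs_lt] at hx
    exact ⟨hx.1, hx.2.le⟩
  refine (measure_mono hset).trans ?_
  rw [gaussianReal_apply_eq_integral _ one_ne_zero]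
  refine ENNReal.ofReal_le_ofReal ?_
  rw [← intervalIntegral.integral_of_le (by norm_num)]
  have hb : ∀ x ∈ Set.Icc (-(3 / 4) : ℝ) (3 / 4), gaussianPDFReal 0 1 x ≤
      (√(2 * Real.pi))⁻¹ * (1 - x ^ 2 / 2 + x ^ 4 / 8) := fun x _ => by
    simp only [gaussianPDFReal, NNReal.coe_one, mul_one, sub_zero]
    gcongr
    have := Real.exp_neg_le_quadratic (x := x ^ 2 / 2) (by positivity)
    rw [neg_div]
    linarith
  refine (intervalIntegral.integral_mono_on (by norm_num)
    (integrable_gaussianPDFReal 0 1).intervalIntegrable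
    (Continuous.intervalIntegrable (by fun_prop) _ _) hb).trans ?_
  rw [intervalIntegral.integral_const_mul]
  have hI : ∫ x in (-(3 / 4) : ℝ)..(3 / 4), (1 - x ^ 2 / 2 + x ^ 4 / 8) =
      2 * (3 / 4 - (3 / 4) ^ 3 / 6 + (3 / 4) ^ 5 / 40) := by
    rw [intervalIntegral.integral_add (Continuous.intervalIntegrable (by fun_prop) _ _)
      (Continuous.intervalIntegrable (by fun_prop) _ _),
      intervalIntegral.integral_sub (Continuous.intervalIntegrable (by fun_prop) _ _)
      (Continuous.intervalIntegrable (by fun_prop) _ _)]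
    simp only [intervalIntegral.integral_div, integral_pow, intervalIntegral.integral_const]
    norm_num
  rw [hI]
  have h2 : √(2 / Real.pi) = (√(2 * Real.pi))⁻¹ * 2 := by
    rw [Real.sqrt_eq_iff_mul_self_eq_of_pos (by positivity)]
    have h3 : √(2 * Real.pi) ^ 2 = 2 * Real.pi := Real.sq_sqrt (by positivity)
    have : 0 < √(2 * Real.pi) := by positivity
    field_simp
    rw [h3]
  rw [h2, mul_assoc]
  gcongr
  norm_num

theorem sqrt_two_div_pi_le : √(2 / Real.pi) ≤ 0.79797 := by
  rw [Real.sqrt_le_left (by norm_num), div_le_iff₀ Real.pi_pos]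
  nlinarith [Real.pi_gt_d4]

/-- This is where 2.35 comes from: a threshold `τ` leads to the constant `√(2/π) / (τ · Pr{|x| ≥
τ})`, and `τ = 3/4` is nearly optimal. -/
theorem le_gaussianReal_le_abs :
    ENNReal.ofReal (√(2 / Real.pi) / (2.35 * (3 / 4))) ≤ gaussianReal 0 1 {x : ℝ | 3 / 4 ≤ |x|} := by
  have hc : {x : ℝ | 3 / 4 ≤ |x|} = {x : ℝ | |x| < 3 / 4}ᶜ := by ext; simp
  have hm : MeasurableSet {x : ℝ | |x| < 3 / 4} := measurableSet_lt (by fun_prop) (by fun_prop)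
  rw [hc, prob_compl_eq_one_sub hm]
  refine le_trans ?_ (tsub_le_tsub_left gaussianReal_abs_lt_le 1)
  rw [← ENNReal.ofReal_one, ← ENNReal.ofReal_sub _ (by positivity)]
  refine ENNReal.ofReal_le_ofReal ?_
  have := sqrt_two_div_pi_le
  rw [div_le_iff₀ (by norm_num)]
  linarith

theorem stdGaussian_le_abs_inner {E : Type*} [NormedAddCommGroup E] [InnerProductSpace ℝ E]
    [FiniteDimensional ℝ E] [MeasurableSpace E] [BorelSpace E] {u : E} (hu : ‖u‖ = 1) :
    ENNReal.ofReal (√(2 / Real.pi) / (2.35 * (3 / 4))) ≤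
      stdGaussian E {v | 3 / 4 ≤ |inner ℝ u v|} := by
  refine le_gaussianReal_le_abs.trans (le_of_eq ?_)
  have h := stdGaussian_map_inner u
  rw [hu, one_pow, Real.toNNReal_one] at h
  rw [← h, Measure.map_apply (by fun_prop) (measurableSet_le (by fun_prop) (by fun_prop))]
  rfl

theorem lintegral_norm_stdGaussian_le (k : ℕ) :
    ∫⁻ v, ENNReal.ofReal ‖v‖ ∂(stdGaussian (EuclideanSpace ℝ (Fin k))) ≤ ENNReal.ofReal √k := by
  set μ := stdGaussian (EuclideanSpace ℝ (Fin k))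
  have hL2 : MemLp id 2 μ := IsGaussian.memLp_two_id
  have hi : Integrable (fun v : EuclideanSpace ℝ (Fin k) => ‖v‖) μ :=
    (hL2.integrable (by norm_num)).norm
  rw [← ofReal_integral_eq_lintegral_ofReal hi (ae_of_all _ fun _ => norm_nonneg _)]
  refine ENNReal.ofReal_le_ofReal (Real.le_sqrt_of_sq_le ?_)
  have hsq : ∫ v, ‖v‖ ^ 2 ∂μ = k := by
    have hcoord (i : Fin k) : ∫ v : EuclideanSpace ℝ (Fin k), (v i) ^ 2 ∂μ = 1 := by
      have h := variance_dual_stdGaussian (innerSL ℝ (EuclideanSpace.single i (1 : ℝ)))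
      rw [variance_of_integral_eq_zero (by fun_prop)
        (integral_strongDual_stdGaussian _)] at h
      simpa [EuclideanSpace.inner_single_left] using h
    simp_rw [EuclideanSpace.real_norm_sq_eq]
    rw [integral_finsetSum]
    · simp [hcoord]
    · intro i _
      have : MemLp (fun v : EuclideanSpace ℝ (Fin k) => v i) 2 μ :=
        (EuclideanSpace.proj (𝕜 := ℝ) i : EuclideanSpace ℝ (Fin k) →L[ℝ] ℝ).comp_memLp' hL2
      exact this.integrable_sq
  -- Nonnegative variance of `‖v‖` says `(E‖v‖)² ≤ E‖v‖² = k`.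
  have hvar := variance_nonneg (fun v : EuclideanSpace ℝ (Fin k) => ‖v‖) μ
  have hn : MemLp (fun v : EuclideanSpace ℝ (Fin k) => ‖v‖) 2 μ := hL2.norm
  rw [variance_eq_sub hn] at hvar
  simp only [Pi.pow_apply] at hvar
  linarith

/-! ### Resampling one Gaussian direction -/

/-- The component in the range of `A` may be replaced by an independent copy. Characteristic
functions match by Pythagoras: `‖t‖² = ‖T t‖² + ‖t - A (T t)‖²`. -/
theorem stdGaussian_eq_conv {E F : Type*} [NormedAddCommGroup E] [InnerProductSpace ℝ E]
    [FiniteDimensional ℝ E] [MeasurableSpace E] [BorelSpace E]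
    [NormedAddCommGroup F] [InnerProductSpace ℝ F]
    [FiniteDimensional ℝ F] [MeasurableSpace F] [BorelSpace F] (A : F →ₗᵢ[ℝ] E)
    (T : E →ₗ[ℝ] F) (hT : ∀ x z, inner ℝ (A x) z = inner ℝ x (T z)) :
    stdGaussian E = ((stdGaussian F).prod (stdGaussian E)).map
      (fun p => A p.1 + (p.2 - A (T p.2))) := by
  have hTA (x : F) : T (A x) = x := ext_inner_left ℝ fun y => by
    rw [← hT, A.inner_map_map]
  have hTc : Continuous T := T.continuous_of_finiteDimensional
  have hA : Measurable A := A.continuous.measurable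
  have hB : Measurable fun z => z - A (T z) := by
    have := A.continuous; fun_prop
  have h1 : ((stdGaussian F).prod (stdGaussian E)).map (fun p => A p.1 + (p.2 - A (T p.2))) =
      ((stdGaussian F).map A).conv ((stdGaussian E).map fun z => z - A (T z)) := by
    rw [Measure.conv, Measure.map_prod_map _ _ hA hB, Measure.map_map (by fun_prop) (by fun_prop)]
    rfl
  rw [h1]
  have := Measure.isProbabilityMeasure_map (μ := stdGaussian F) hA.aemeasurable
  have := Measure.isProbabilityMeasure_map (μ := stdGaussian E) hB.aemeasurable
  refine Measure.ext_of_charFun ?_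
  ext t
  rw [charFun_conv, charFun_stdGaussian]
  have e1 : charFun ((stdGaussian F).map A) t = charFun (stdGaussian F) (T t) := by
    rw [charFun_apply, charFun_apply, integral_map (by fun_prop) (by fun_prop)]
    simp_rw [hT]
  have e2 : charFun ((stdGaussian E).map fun z => z - A (T z)) t =
      charFun (stdGaussian E) (t - A (T t)) := by
    rw [charFun_apply, charFun_apply, integral_map (by fun_prop) (by fun_prop)]
    congr 1 with z
    rw [inner_sub_left, inner_sub_right, hT, real_inner_comm (A (T t)) z, hT,
      real_inner_comm (T z)]
  rw [e1, e2, charFun_stdGaussian, charFun_stdGaussian, ← Complex.exp_add]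
  congr 1
  have h2 : ‖t - A (T t)‖ ^ 2 = ‖t‖ ^ 2 - ‖T t‖ ^ 2 := by
    rw [norm_sub_sq_real, real_inner_comm, hT, A.norm_map, real_inner_self_eq_norm_sq]; ring
  rw [← Complex.ofReal_pow, ← Complex.ofReal_pow, ← Complex.ofReal_pow, h2]
  push_cast; ring

theorem exists_mem_orthogonal_of_finrank_lt {H : Type*} [NormedAddCommGroup H]
    [InnerProductSpace ℝ H] [FiniteDimensional ℝ H] (D R : Submodule ℝ H)
    (h : Module.finrank ℝ D < Module.finrank ℝ R) :
    ∃ w ∈ R, w ∈ Dᗮ ∧ ‖w‖ = 1 := by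
  have hne : R ⊓ Dᗮ ≠ ⊥ := fun hbot => by
    have h1 := Submodule.finrank_add_finrank_le_of_disjoint (disjoint_iff.2 hbot)
    have h2 := Submodule.finrank_add_finrank_orthogonal D
    omega
  obtain ⟨w, hw, hw0⟩ := Submodule.exists_mem_ne_zero_of_ne_bot hne
  refine ⟨‖w‖⁻¹ • w, R.smul_mem _ hw.1, Dᗮ.smul_mem _ hw.2, ?_⟩
  rw [norm_smul, norm_inv, norm_norm, inv_mul_cancel₀ (norm_ne_zero_iff.2 hw0)]

section

variable {E F H K : Type*} [NormedAddCommGroup E] [InnerProductSpace ℝ E]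
  [FiniteDimensional ℝ E] [MeasurableSpace E] [BorelSpace E]
  [NormedAddCommGroup F] [InnerProductSpace ℝ F]
  [FiniteDimensional ℝ F] [MeasurableSpace F] [BorelSpace F]
  [NormedAddCommGroup H] [InnerProductSpace ℝ H] [FiniteDimensional ℝ H]
  [NormedAddCommGroup K] [InnerProductSpace ℝ K] [FiniteDimensional ℝ K]

/-- Here `T u Z` models `uᵀZ` and `A x` models `v xᵀ`. Resampling along `A` makes the row `T v` a
fresh Gaussian, while `T u` for `u ⊥ v` is unaffected by it. -/
theorem stdGaussian_exists_inner_eq_one_le (T : K →ₗ[ℝ] E →ₗ[ℝ] F) {v : K} (hv : ‖v‖ = 1)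
    (A : F →ₗᵢ[ℝ] E) (hA : ∀ x z, inner ℝ (A x) z = inner ℝ x (T v z))
    (hTA : ∀ u x, T u (A x) = inner ℝ u v • x) (N : F →ₗ[ℝ] H)
    (hN : Module.finrank ℝ K ≤ Module.finrank ℝ N.range) {δ : ℝ} (hδ : 0 < δ)
    (hNδ : ∀ w ∈ N.range, δ * ‖w‖ ≤ ‖LinearMap.adjoint N w‖) (B : E) {σ t : ℝ} (hσ : 0 < σ)
    (ht : 0 ≤ t) {S : Set E} (hSm : MeasurableSet S)
    (hS : ∀ z ∈ S, ∃ u, inner ℝ u v = 1 ∧ ‖N (T u (B + σ • z))‖ ≤ t) :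
    stdGaussian E S ≤ ENNReal.ofReal (√(2 / Real.pi) * t / (σ * δ)) := by
  have hTc : Continuous (T v) := (T v).continuous_of_finiteDimensional
  have hAc : Continuous A := A.continuous
  have hmeas : Measurable fun p : F × E => A p.1 + (p.2 - A (T v p.2)) := by fun_prop
  rw [stdGaussian_eq_conv A (T v) hA, Measure.map_apply hmeas hSm,
    Measure.prod_apply_symm (hmeas hSm)]
  refine (lintegral_mono fun z => ?_).trans (lintegral_const _).le |>.trans (by rw [measure_univ, mul_one])
  -- With `z` frozen, `D` contains every contribution of `u - v` and does not depend on the fresh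
  -- Gaussian `g`; the normal `w` to `D` may therefore be treated as fixed.
  let C : K →ₗ[ℝ] H := N ∘ₗ (T.flip (B + σ • z))
  let D : Submodule ℝ H := (ℝ ∙ v)ᗮ.map C
  have hv0 : v ≠ 0 := fun h => by simp [h] at hv
  have hD : Module.finrank ℝ D < Module.finrank ℝ N.range := by
    have h1 := Submodule.finrank_add_finrank_orthogonal (ℝ ∙ v)
    rw [finrank_span_singleton hv0] at h1
    have h2 := Submodule.finrank_map_le C (ℝ ∙ v)ᗮ
    change Module.finrank ℝ ((ℝ ∙ v)ᗮ.map C) < _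
    omega
  obtain ⟨w, hwR, hwD, hw1⟩ := exists_mem_orthogonal_of_finrank_lt D _ hD
  have hNw : δ ≤ ‖LinearMap.adjoint N w‖ := by simpa [hw1] using hNδ w hwR
  have hw' : σ • LinearMap.adjoint N w ≠ 0 :=
    smul_ne_zero hσ.ne' (norm_pos_iff.1 (hδ.trans_le hNw))
  have hsub : (fun g => (g, z)) ⁻¹' ((fun p : F × E => A p.1 + (p.2 - A (T v p.2))) ⁻¹' S) ⊆
      {g | |inner ℝ w (N (T v B)) + inner ℝ (σ • LinearMap.adjoint N w) g| ≤ t} := by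
    intro g hg
    obtain ⟨u, huv, hu⟩ := hS _ hg
    have hvv : inner ℝ v v = (1 : ℝ) := by rw [real_inner_self_eq_norm_sq, hv, one_pow]
    have horth : u - v ∈ (ℝ ∙ v)ᗮ := by
      rw [Submodule.mem_orthogonal_singleton_iff_inner_left, inner_sub_left, huv, hvv, sub_self]
    have h0 : inner ℝ w (C (u - v)) = 0 :=
      Submodule.inner_left_of_mem_orthogonal (Submodule.mem_map_of_mem horth) hwD
    have hval : N (T u (B + σ • (A g + (z - A (T v z))))) =
        C (u - v) + N (T v B) + σ • N g := by
      have hC (x : K) : C x = N (T x (B + σ • z)) := rfl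
      simp only [hC, map_add, map_sub, map_smul, hTA, huv, LinearMap.sub_apply, one_smul,
        smul_sub, smul_add]
      abel
    rw [Set.mem_ofPred_eq]
    have h1 : inner ℝ w (N (T v B)) + inner ℝ (σ • LinearMap.adjoint N w) g =
        inner ℝ w (N (T u (B + σ • (A g + (z - A (T v z)))))) := by
      rw [hval, inner_add_right, inner_add_right, h0, zero_add, real_inner_smul_left,
        real_inner_smul_right, LinearMap.adjoint_inner_left]
    rw [h1]
    exact (abs_real_inner_le_norm _ _).trans (by rw [hw1, one_mul]; exact hu)
  refine (measure_mono hsub).trans ((stdGaussian_abs_add_inner_le hw' _ _).trans ?_)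
  refine ENNReal.ofReal_le_ofReal ?_
  rw [norm_smul, Real.norm_of_nonneg hσ.le]
  exact div_le_div_of_nonneg_left (mul_nonneg (Real.sqrt_nonneg _) ht) (mul_pos hσ hδ)
    (mul_le_mul_of_nonneg_left hNw hσ.le)

end

/-! ### Small row combinations of a Gaussian matrix -/

/-- The linear combination `uᵀ Z` of the rows of `Z`. -/
noncomputable def rowComb (k m : ℕ) : EuclideanSpace ℝ (Fin k) →ₗ[ℝ]
    EuclideanSpace ℝ (Fin k × Fin m) →ₗ[ℝ] EuclideanSpace ℝ (Fin m) :=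
  LinearMap.mk₂ ℝ (fun u Z => WithLp.toLp 2 fun j => ∑ i, u i * Z (i, j))
    (fun u u' Z => by ext j; simp [add_mul, Finset.sum_add_distrib])
    (fun c u Z => by ext j; simp [mul_assoc, Finset.mul_sum])
    (fun u Z Z' => by ext j; simp [mul_add, Finset.sum_add_distrib])
    (fun c u Z => by ext j; simp [mul_left_comm, Finset.mul_sum])

@[simp] theorem rowComb_apply {k m : ℕ} (u : EuclideanSpace ℝ (Fin k))
    (Z : EuclideanSpace ℝ (Fin k × Fin m)) (j : Fin m) :
    rowComb k m u Z j = ∑ i, u i * Z (i, j) := rfl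

/-- The isometric embedding `x ↦ v xᵀ` for a unit vector `v`. -/
noncomputable def outerIsometry {k : ℕ} (m : ℕ) (v : EuclideanSpace ℝ (Fin k)) (hv : ‖v‖ = 1) :
    EuclideanSpace ℝ (Fin m) →ₗᵢ[ℝ] EuclideanSpace ℝ (Fin k × Fin m) where
  toFun x := WithLp.toLp 2 fun p => v p.1 * x p.2
  map_add' x y := by ext p; simp [mul_add]
  map_smul' c x := by ext p; simp [mul_left_comm]
  norm_map' x := by
    rw [← sq_eq_sq₀ (norm_nonneg _) (norm_nonneg _)]
    simp only [LinearMap.coe_mk, AddHom.coe_mk]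
    have hv2 := EuclideanSpace.real_norm_sq_eq v
    rw [hv, one_pow] at hv2
    rw [EuclideanSpace.real_norm_sq_eq, EuclideanSpace.real_norm_sq_eq, Fintype.sum_prod_type]
    simp only [mul_pow, ← Finset.mul_sum, ← Finset.sum_mul, ← hv2, one_mul]

@[simp] theorem outerIsometry_apply {k m : ℕ} {v : EuclideanSpace ℝ (Fin k)} (hv : ‖v‖ = 1)
    (x : EuclideanSpace ℝ (Fin m)) (p : Fin k × Fin m) :
    outerIsometry m v hv x p = v p.1 * x p.2 := rfl

theorem inner_outerIsometry_left {k m : ℕ} {v : EuclideanSpace ℝ (Fin k)} (hv : ‖v‖ = 1)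
    (x : EuclideanSpace ℝ (Fin m)) (Z : EuclideanSpace ℝ (Fin k × Fin m)) :
    inner ℝ (outerIsometry m v hv x) Z = inner ℝ x (rowComb k m v Z) := by
  simp only [PiLp.inner_apply, RCLike.inner_apply, conj_trivial, Fintype.sum_prod_type_right,
    outerIsometry_apply, rowComb_apply, Finset.sum_mul]
  exact Finset.sum_congr rfl fun j _ => Finset.sum_congr rfl fun i _ => by ring

theorem rowComb_outerIsometry {k m : ℕ} {v : EuclideanSpace ℝ (Fin k)} (hv : ‖v‖ = 1)
    (u : EuclideanSpace ℝ (Fin k)) (x : EuclideanSpace ℝ (Fin m)) :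
    rowComb k m u (outerIsometry m v hv x) = inner ℝ u v • x := by
  ext j
  simp only [PiLp.inner_apply, RCLike.inner_apply, conj_trivial, PiLp.smul_apply, smul_eq_mul,
    outerIsometry_apply, rowComb_apply, Finset.sum_mul]
  exact Finset.sum_congr rfl fun i _ => by ring

/-- Projection along a compact sphere is a closed map; this supplies the measurability that Fubini
needs. -/
theorem isClosed_exists_norm_eq_one {K X : Type*} [NormedAddCommGroup K] [NormedSpace ℝ K]
    [FiniteDimensional ℝ K] [TopologicalSpace X] {Q : Set (K × X)} (hQ : IsClosed Q) :
    IsClosed {x | ∃ u : K, ‖u‖ = 1 ∧ (u, x) ∈ Q} := by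
  have : ProperSpace K := FiniteDimensional.proper ℝ K
  have : CompactSpace (Metric.sphere (0 : K) 1) :=
    isCompact_iff_compactSpace.1 (isCompact_sphere 0 1)
  have h := isClosedMap_snd_of_compactSpace (X := Metric.sphere (0 : K) 1) (Y := X)
    _ (hQ.preimage (f := fun p : Metric.sphere (0 : K) 1 × X => (p.1.1, p.2)) (by fun_prop))
  convert h using 1
  ext x
  simp

theorem stdGaussian_exists_norm_rowComb_le {k m : ℕ} {H : Type*} [NormedAddCommGroup H]
    [InnerProductSpace ℝ H] [FiniteDimensional ℝ H] (N : EuclideanSpace ℝ (Fin m) →ₗ[ℝ] H)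
    (hN : k ≤ Module.finrank ℝ N.range) {δ : ℝ} (hδ : 0 < δ)
    (hNδ : ∀ w ∈ N.range, δ * ‖w‖ ≤ ‖LinearMap.adjoint N w‖)
    (B : EuclideanSpace ℝ (Fin k × Fin m)) {σ y : ℝ} (hσ : 0 < σ) (hy : 0 ≤ y) :
    stdGaussian (EuclideanSpace ℝ (Fin k × Fin m))
      {Z | ∃ u, ‖u‖ = 1 ∧ ‖N (rowComb k m u (B + σ • Z))‖ ≤ y} ≤
      ENNReal.ofReal (2.35 * y * √k / (σ * δ)) := by
  set f : EuclideanSpace ℝ (Fin k) × EuclideanSpace ℝ (Fin k × Fin m) → H :=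
    fun p => N (rowComb k m p.1 (B + σ • p.2)) with hf
  have hfc : Continuous f := by
    have h1 : Continuous N := N.continuous_of_finiteDimensional
    refine h1.comp ((PiLp.continuous_toLp 2 _).comp (continuous_pi fun j => ?_))
    change Continuous fun p : (EuclideanSpace ℝ (Fin k)) × (EuclideanSpace ℝ (Fin k × Fin m)) =>
      ∑ i, p.1 i * (B + σ • p.2) (i, j)
    fun_prop
  -- Pairs `(Z, v)` for which a single bad `u` for `Z` also correlates with `v`. The measure of `Q`
  -- is bounded below by slicing at `Z` and above by slicing at `v`.
  set Q : Set ((EuclideanSpace ℝ (Fin k × Fin m)) × (EuclideanSpace ℝ (Fin k))) :=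
    {p | ∃ u : EuclideanSpace ℝ (Fin k), ‖u‖ = 1 ∧
      (u, p) ∈ {q : EuclideanSpace ℝ (Fin k) × (EuclideanSpace ℝ (Fin k × Fin m) × EuclideanSpace ℝ (Fin k)) |
        ‖f (q.1, q.2.1)‖ ≤ y ∧ 3 / 4 ≤ |inner ℝ q.1 q.2.2|}} with hQ
  have hQm : MeasurableSet Q := by
    refine (isClosed_exists_norm_eq_one ?_).measurableSet
    have h1 : Continuous fun q : EuclideanSpace ℝ (Fin k) ×
        (EuclideanSpace ℝ (Fin k × Fin m) × EuclideanSpace ℝ (Fin k)) => ‖f (q.1, q.2.1)‖ :=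
      (hfc.comp (by fun_prop)).norm
    have h2 : Continuous fun q : EuclideanSpace ℝ (Fin k) ×
        (EuclideanSpace ℝ (Fin k × Fin m) × EuclideanSpace ℝ (Fin k)) =>
        |inner ℝ q.1 q.2.2| := by fun_prop
    exact (isClosed_le h1 continuous_const).inter (isClosed_le continuous_const h2)
  set c := √(2 / Real.pi) with hc
  have hc0 : 0 < c := by positivity
  have hsec (v : EuclideanSpace ℝ (Fin k)) :
      stdGaussian (EuclideanSpace ℝ (Fin k × Fin m)) ((fun Z => (Z, v)) ⁻¹' Q) ≤
      ENNReal.ofReal (c * (y / (3 / 4)) / (σ * δ)) * ENNReal.ofReal ‖v‖ := by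
    rcases eq_or_ne v 0 with rfl | hv
    · have : (fun Z => (Z, (0 : (EuclideanSpace ℝ (Fin k))))) ⁻¹' Q = ∅ := by
        ext Z
        simp only [hQ, Set.mem_preimage, Set.mem_ofPred_eq, inner_zero_right, abs_zero,
          Set.mem_empty_iff_false, iff_false]
        rintro ⟨u, -, -, h⟩
        norm_num at h
      simp [this]
    have hvp : 0 < ‖v‖ := norm_pos_iff.2 hv
    have hv1 : ‖‖v‖⁻¹ • v‖ = 1 := by
      rw [norm_smul, norm_inv, norm_norm, inv_mul_cancel₀ hvp.ne']
    rw [← ENNReal.ofReal_mul (by positivity)]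
    refine (stdGaussian_exists_inner_eq_one_le (rowComb k m) hv1 (outerIsometry m _ hv1)
      (inner_outerIsometry_left hv1) (rowComb_outerIsometry hv1) N (by simpa using hN) hδ hNδ B
      hσ (t := y / (3 / 4) * ‖v‖) (by positivity) (measurable_prodMk_right hQm) ?_).trans
      (le_of_eq (by rw [← hc]; ring_nf))
    rintro Z ⟨u, hu, h1, h2⟩
    simp only [hf] at h1
    simp only at h2
    set τ := inner ℝ u (‖v‖⁻¹ • v) with hτ
    have hτv : |inner ℝ u v| = |τ| * ‖v‖ := by
      rw [hτ, real_inner_smul_right, abs_mul, abs_inv, abs_norm]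
      field_simp
    have hτ0 : 0 < |τ| := by
      by_contra h
      have : |τ| = 0 := le_antisymm (not_lt.1 h) (abs_nonneg _)
      rw [hτv, this] at h2
      norm_num at h2
    -- Since `|τ| * ‖v‖ ≥ 3/4`, rescaling by `τ⁻¹` multiplies norms by at most `‖v‖ / (3/4)`.
    refine ⟨τ⁻¹ • u, ?_, ?_⟩
    · rw [real_inner_smul_left, ← hτ, inv_mul_cancel₀ (abs_pos.1 hτ0)]
    · rw [map_smul, LinearMap.smul_apply, map_smul, norm_smul, norm_inv, Real.norm_eq_abs,
        inv_mul_le_iff₀ hτ0]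
      refine h1.trans ?_
      rw [hτv] at h2
      calc y = y / (3 / 4) * (3 / 4) := by ring
        _ ≤ y / (3 / 4) * (|τ| * ‖v‖) := by gcongr
        _ = _ := by ring
  set S : Set (EuclideanSpace ℝ (Fin k × Fin m)) :=
    {Z | ∃ u, ‖u‖ = 1 ∧ ‖N (rowComb k m u (B + σ • Z))‖ ≤ y} with hS
  have hkey : ENNReal.ofReal (c / (2.35 * (3 / 4))) * stdGaussian (EuclideanSpace ℝ (Fin k × Fin m)) S ≤
      ENNReal.ofReal (c * (y / (3 / 4)) / (σ * δ)) * ENNReal.ofReal √k := by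
    calc _ = ∫⁻ _ in S, ENNReal.ofReal (c / (2.35 * (3 / 4))) ∂(stdGaussian _) :=
          (setLIntegral_const _ _).symm
      _ ≤ ∫⁻ Z in S, stdGaussian (EuclideanSpace ℝ (Fin k)) (Prod.mk Z ⁻¹' Q) ∂(stdGaussian _) := by
          refine setLIntegral_mono (measurable_measure_prodMk_left hQm) fun Z hZ => ?_
          obtain ⟨u, hu, h⟩ := hZ
          exact (stdGaussian_le_abs_inner hu).trans
            (measure_mono fun v hv => ⟨u, hu, h, hv⟩)
      _ ≤ ∫⁻ Z, stdGaussian (EuclideanSpace ℝ (Fin k)) (Prod.mk Z ⁻¹' Q) ∂(stdGaussian _) :=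
          setLIntegral_le_lintegral _ _
      _ = ∫⁻ v, stdGaussian (EuclideanSpace ℝ (Fin k × Fin m)) ((fun Z => (Z, v)) ⁻¹' Q) ∂(stdGaussian _) := by
          rw [← Measure.prod_apply hQm, Measure.prod_apply_symm hQm]
      _ ≤ ∫⁻ v, ENNReal.ofReal (c * (y / (3 / 4)) / (σ * δ)) * ENNReal.ofReal ‖v‖
            ∂(stdGaussian _) := lintegral_mono hsec
      _ = ENNReal.ofReal (c * (y / (3 / 4)) / (σ * δ)) *
            ∫⁻ v, ENNReal.ofReal ‖v‖ ∂(stdGaussian _) :=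
          lintegral_const_mul _ (by fun_prop)
      _ ≤ _ := by gcongr; exact lintegral_norm_stdGaussian_le k
  have hp : 0 < c / (2.35 * (3 / 4)) := by positivity
  refine (ENNReal.mul_le_mul_iff_right (a := ENNReal.ofReal (c / (2.35 * (3 / 4))))
    (by simpa using hp) ENNReal.ofReal_ne_top).1 (hkey.trans (le_of_eq ?_))
  rw [← ENNReal.ofReal_mul (by positivity), ← ENNReal.ofReal_mul (by positivity)]
  congr 1
  field_simp

/-! ### Pseudo-inverses, spectral norms and ranks -/

theorem IsMoorePenrose.transpose {m n : ℕ} {A : Matrix (Fin m) (Fin n) ℝ}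
    {X : Matrix (Fin n) (Fin m) ℝ} (h : IsMoorePenrose A X) : IsMoorePenrose Aᵀ Xᵀ where
  mul_mul_self := by
    rw [← Matrix.transpose_mul, ← Matrix.transpose_mul, ← Matrix.mul_assoc, h.mul_mul_self]
  self_mul_mul := by
    rw [← Matrix.transpose_mul, ← Matrix.transpose_mul, ← Matrix.mul_assoc, h.self_mul_mul]
  symm_left := by rw [← Matrix.transpose_mul, h.symm_right, h.symm_right]
  symm_right := by rw [← Matrix.transpose_mul, h.symm_left, h.symm_left]

theorem pinv_transpose {m n : ℕ} (A : Matrix (Fin m) (Fin n) ℝ) : pinv Aᵀ = (pinv A)ᵀ :=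
  (pinv_spec Aᵀ).unique (pinv_spec A).transpose

theorem pinv_zero {m n : ℕ} : pinv (0 : Matrix (Fin m) (Fin n) ℝ) = 0 := by
  have h := (pinv_spec (0 : Matrix (Fin m) (Fin n) ℝ)).self_mul_mul
  simpa using h.symm

theorem pinv_ne_zero {m n : ℕ} {A : Matrix (Fin m) (Fin n) ℝ} (hA : A ≠ 0) : pinv A ≠ 0 :=
  fun h => hA (by simpa [h] using (pinv_spec A).mul_mul_self.symm)

theorem l2_opNorm_transpose {m n : ℕ} (A : Matrix (Fin m) (Fin n) ℝ) : ‖Aᵀ‖ = ‖A‖ := by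
  rw [← Matrix.conjTranspose_eq_transpose_of_trivial, Matrix.l2_opNorm_conjTranspose]

theorem norm_pinv_transpose {m n : ℕ} (A : Matrix (Fin m) (Fin n) ℝ) :
    ‖pinv Aᵀ‖ = ‖pinv A‖ := by
  rw [pinv_transpose, l2_opNorm_transpose]

theorem norm_toEuclideanLin_le {m n : ℕ} (A : Matrix (Fin m) (Fin n) ℝ)
    (x : EuclideanSpace ℝ (Fin n)) : ‖Matrix.toEuclideanLin A x‖ ≤ ‖A‖ * ‖x‖ :=
  A.l2_opNorm_mulVec x

theorem l2_opNorm_le_of_forall {m n : ℕ} (A : Matrix (Fin m) (Fin n) ℝ) {c : ℝ} (hc : 0 ≤ c)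
    (h : ∀ x, ‖Matrix.toEuclideanLin A x‖ ≤ c * ‖x‖) : ‖A‖ ≤ c := by
  rw [Matrix.l2_opNorm_def]
  exact ContinuousLinearMap.opNorm_le_bound _ hc h

theorem toEuclideanLin_mul_apply {l m n : ℕ} (A : Matrix (Fin l) (Fin m) ℝ)
    (B : Matrix (Fin m) (Fin n) ℝ) (x : EuclideanSpace ℝ (Fin n)) :
    Matrix.toEuclideanLin (A * B) x = Matrix.toEuclideanLin A (Matrix.toEuclideanLin B x) := by
  simp [Matrix.toLpLin_apply, Matrix.mulVec_mulVec]

theorem adjoint_toEuclideanLin {m n : ℕ} (A : Matrix (Fin m) (Fin n) ℝ) :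
    LinearMap.adjoint (Matrix.toEuclideanLin A) = Matrix.toEuclideanLin Aᵀ := by
  rw [← Matrix.toEuclideanLin_conjTranspose_eq_adjoint,
    Matrix.conjTranspose_eq_transpose_of_trivial]

theorem finrank_range_toEuclideanLin {m n : ℕ} (A : Matrix (Fin m) (Fin n) ℝ) :
    Module.finrank ℝ (Matrix.toEuclideanLin A).range = A.rank := by
  rw [Matrix.toEuclideanLin_eq_toLin_orthonormal, ← Matrix.rank_eq_finrank_range_toLin]

/-- An orthogonal projection has spectral norm at most `1`. -/
theorem norm_le_one_of_symm_of_idem {n : ℕ} {E : Matrix (Fin n) (Fin n) ℝ} (h1 : Eᵀ = E)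
    (h2 : E * E = E) : ‖E‖ ≤ 1 := by
  have h := Matrix.l2_opNorm_conjTranspose_mul_self E
  rw [Matrix.conjTranspose_eq_transpose_of_trivial, h1, h2] at h
  by_contra! hlt
  nlinarith

theorem norm_mul_pinv_le_one {m n : ℕ} (A : Matrix (Fin m) (Fin n) ℝ) : ‖A * pinv A‖ ≤ 1 :=
  norm_le_one_of_symm_of_idem (pinv_spec A).symm_left
    (by rw [← Matrix.mul_assoc, (pinv_spec A).mul_mul_self])

theorem norm_pinv_mul_le_one {m n : ℕ} (A : Matrix (Fin m) (Fin n) ℝ) : ‖pinv A * A‖ ≤ 1 :=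
  norm_le_one_of_symm_of_idem (pinv_spec A).symm_right
    (by rw [← Matrix.mul_assoc, (pinv_spec A).self_mul_mul])

theorem transpose_eq_pinv_mul_mul_transpose {m n : ℕ} (A : Matrix (Fin m) (Fin n) ℝ) :
    Aᵀ = pinv A * A * Aᵀ := by
  conv_lhs => rw [← (pinv_spec A).mul_mul_self, Matrix.mul_assoc, Matrix.transpose_mul,
    (pinv_spec A).symm_right]

theorem rank_ne_zero_of_ne_zero {m n : ℕ} {A : Matrix (Fin m) (Fin n) ℝ} (hA : A ≠ 0) :
    A.rank ≠ 0 := fun h => by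
  rw [← finrank_range_toEuclideanLin, Submodule.finrank_eq_zero, LinearMap.range_eq_bot] at h
  exact hA (by simpa using h)

/-- An eigenvector `x` of `AᵀA` for `s²` lies in the row space of `A`, so `x = A⁺(A x)` and `‖x‖ ≤
‖A⁺‖ s ‖x‖`. This direction suffices to transfer the probability bound. -/
theorem one_div_norm_pinv_le_sigmaMin {m n : ℕ} (A : Matrix (Fin m) (Fin n) ℝ) :
    1 / ‖pinv A‖ ≤ sigmaMin A := by
  rcases eq_or_ne A 0 with rfl | hA
  · rw [pinv_zero, norm_zero, div_zero]
    exact LinearMap.singularValues_nonneg _ _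
  set s := sigmaMin A with hs
  have hrank : A.rank ≠ 0 := rank_ne_zero_of_ne_zero hA
  have hpos : 0 < s := by
    rw [hs, sigmaMin, LinearMap.singularValues_pos_iff_lt_finrank_range,
      finrank_range_toEuclideanLin]
    omega
  have hlt : A.rank - 1 < Module.finrank ℝ (EuclideanSpace ℝ (Fin n)) := by
    have := A.rank_le_width
    simp; omega
  obtain ⟨x, hx, hx0⟩ := ((Matrix.toEuclideanLin A).hasEigenvalue_adjoint_comp_self_sq_singularValues
    hlt).exists_hasEigenvector
  rw [Module.End.mem_eigenspace_iff] at hx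
  change _ = s ^ 2 • x at hx
  rw [LinearMap.comp_apply] at hx
  have hnorm : ‖Matrix.toEuclideanLin A x‖ = s * ‖x‖ := by
    rw [← sq_eq_sq₀ (norm_nonneg _) (by positivity), ← real_inner_self_eq_norm_sq,
      ← LinearMap.adjoint_inner_right, hx, real_inner_smul_right, real_inner_self_eq_norm_sq]
    ring
  have hproj : Matrix.toEuclideanLin (pinv A * A) x = x := by
    rw [adjoint_toEuclideanLin] at hx
    have hx' : x = (s ^ 2)⁻¹ • Matrix.toEuclideanLin Aᵀ (Matrix.toEuclideanLin A x) := by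
      rw [hx, smul_smul, inv_mul_cancel₀ (by positivity), one_smul]
    rw [hx', map_smul, ← toEuclideanLin_mul_apply, ← transpose_eq_pinv_mul_mul_transpose]
  have hle : ‖x‖ ≤ ‖pinv A‖ * (s * ‖x‖) := by
    conv_lhs => rw [← hproj, toEuclideanLin_mul_apply]
    exact (norm_toEuclideanLin_le _ _).trans_eq (by rw [hnorm])
  have hx1 : 0 < ‖x‖ := norm_pos_iff.2 hx0
  rw [div_le_iff₀ (norm_pos_iff.2 (pinv_ne_zero hA))]
  nlinarith

theorem norm_le_of_mem_range_transpose {m n : ℕ} {M : Matrix (Fin m) (Fin n) ℝ} (hM : M ≠ 0)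
    (w : EuclideanSpace ℝ (Fin n)) (hw : w ∈ (Matrix.toEuclideanLin Mᵀ).range) :
    ‖pinv M‖⁻¹ * ‖w‖ ≤ ‖LinearMap.adjoint (Matrix.toEuclideanLin Mᵀ) w‖ := by
  obtain ⟨x, rfl⟩ := hw
  rw [adjoint_toEuclideanLin, Matrix.transpose_transpose,
    inv_mul_le_iff₀ (norm_pos_iff.2 (pinv_ne_zero hM))]
  conv_lhs => rw [transpose_eq_pinv_mul_mul_transpose, toEuclideanLin_mul_apply,
    toEuclideanLin_mul_apply]
  exact norm_toEuclideanLin_le _ _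

theorem norm_submatrix_one_le {k r : ℕ} {e : Fin k → Fin r} (he : e.Injective) :
    ‖(1 : Matrix (Fin r) (Fin r) ℝ).submatrix e id‖ ≤ 1 := by
  set J := (1 : Matrix (Fin r) (Fin r) ℝ).submatrix e id with hJ
  have hJJ : J * Jᵀ = 1 := by
    ext i j
    simp [hJ, Matrix.mul_apply, Matrix.one_apply, he.eq_iff]
  have h := Matrix.l2_opNorm_conjTranspose_mul_self Jᵀ
  rw [Matrix.conjTranspose_eq_transpose_of_trivial, Matrix.transpose_transpose, hJJ,
    l2_opNorm_transpose] at h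
  have h1 : ‖(1 : Matrix (Fin k) (Fin k) ℝ)‖ ≤ 1 :=
    norm_le_one_of_symm_of_idem Matrix.transpose_one (Matrix.one_mul 1)
  by_contra! hlt
  nlinarith

/-- The hypothesis says that the selected rows span the row space. Then `A⁺ = A₁⁺ J (A A⁺)`, with a
row selection `J` and a projection `A A⁺`, both of norm at most 1. -/
theorem norm_pinv_le_norm_pinv_submatrix {k r n : ℕ} (A : Matrix (Fin r) (Fin n) ℝ)
    {e : Fin k → Fin r} (he : e.Injective)
    (h : A * (pinv (A.submatrix e id) * A.submatrix e id) = A) :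
    ‖pinv A‖ ≤ ‖pinv (A.submatrix e id)‖ := by
  set A₁ := A.submatrix e id with hA₁
  set J := (1 : Matrix (Fin r) (Fin r) ℝ).submatrix e id with hJ
  have hJA : J * A = A₁ := by
    ext i j
    simp [hJ, hA₁, Matrix.mul_apply, Matrix.one_apply]
  have h1 : pinv A₁ * A₁ * (pinv A * A) = pinv A * A := by
    have h2 : pinv A * A * (pinv A₁ * A₁) = pinv A * A := by rw [Matrix.mul_assoc, h]
    have h3 := congrArg Matrix.transpose h2
    rwa [Matrix.transpose_mul, (pinv_spec A).symm_right, (pinv_spec A₁).symm_right] at h3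
  have h2 : pinv A = pinv A₁ * J * (A * pinv A) := by
    calc pinv A = pinv A * A * pinv A := (pinv_spec A).self_mul_mul.symm
      _ = pinv A₁ * A₁ * (pinv A * A) * pinv A := by rw [h1]
      _ = pinv A₁ * (J * A) * (pinv A * A * pinv A) := by
          rw [hJA]; simp only [Matrix.mul_assoc]
      _ = _ := by rw [(pinv_spec A).self_mul_mul]; simp only [Matrix.mul_assoc]
  calc ‖pinv A‖ = ‖pinv A₁ * J * (A * pinv A)‖ := by rw [← h2]
    _ ≤ ‖pinv A₁ * J‖ * ‖A * pinv A‖ := Matrix.l2_opNorm_mul _ _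
    _ ≤ ‖pinv A₁ * J‖ * 1 := by gcongr; exact norm_mul_pinv_le_one A
    _ ≤ ‖pinv A₁‖ * ‖J‖ * 1 := by gcongr; exact Matrix.l2_opNorm_mul _ _
    _ ≤ ‖pinv A₁‖ * 1 * 1 := by gcongr; exact norm_submatrix_one_le he
    _ = _ := by ring

/-- Compactness of the sphere gives a minimum `c > y` of `‖Aᵀu‖`. As `Aᵀ(A⁺)ᵀ` is a projection, `c *
‖(A⁺)ᵀz‖ ≤ ‖z‖`. -/
theorem mul_norm_pinv_lt_one {k n : ℕ} (hk : 0 < k) {A : Matrix (Fin k) (Fin n) ℝ} {y : ℝ}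
    (hy : 0 ≤ y) (h : ∀ u, ‖u‖ = 1 → y < ‖Matrix.toEuclideanLin Aᵀ u‖) :
    y * ‖pinv A‖ < 1 := by
  have : Nonempty (Fin k) := ⟨⟨0, hk⟩⟩
  have hc : Continuous fun u => ‖Matrix.toEuclideanLin Aᵀ u‖ :=
    (LinearMap.continuous_of_finiteDimensional _).norm
  obtain ⟨u₀, hu₀, hmin⟩ := (isCompact_sphere (0 : EuclideanSpace ℝ (Fin k)) 1).exists_isMinOn
    (NormedSpace.sphere_nonempty.2 zero_le_one) hc.continuousOn
  set c := ‖Matrix.toEuclideanLin Aᵀ u₀‖ with hc'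
  have hyc : y < c := h u₀ (by simpa using hu₀)
  have hc0 : 0 < c := hy.trans_lt hyc
  have hlow (x : EuclideanSpace ℝ (Fin k)) : c * ‖x‖ ≤ ‖Matrix.toEuclideanLin Aᵀ x‖ := by
    rcases eq_or_ne x 0 with rfl | hx
    · simp
    have hx' : 0 < ‖x‖ := norm_pos_iff.2 hx
    have h1 : c ≤ ‖Matrix.toEuclideanLin Aᵀ (‖x‖⁻¹ • x)‖ :=
      hmin (by simp [norm_smul, hx'.ne'])
    rw [map_smul, norm_smul, norm_inv, norm_norm, le_inv_mul_iff₀ hx'] at h1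
    linarith
  have hnorm : ‖pinv A‖ ≤ c⁻¹ := by
    rw [← l2_opNorm_transpose]
    refine l2_opNorm_le_of_forall _ (by positivity) fun z => ?_
    rw [le_inv_mul_iff₀ hc0]
    refine (hlow _).trans ?_
    rw [← toEuclideanLin_mul_apply, ← Matrix.transpose_mul, (pinv_spec A).symm_right]
    refine (norm_toEuclideanLin_le _ _).trans ?_
    exact mul_le_of_le_one_left (norm_nonneg _) (norm_pinv_mul_le_one A)
  calc y * ‖pinv A‖ ≤ y * c⁻¹ := by gcongr
    _ < 1 := by rw [← div_eq_mul_inv, div_lt_one hc0]; exact hyc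

theorem rank_eq_of_forall_norm_pos {k n : ℕ} {A : Matrix (Fin k) (Fin n) ℝ}
    (h : ∀ u, ‖u‖ = 1 → 0 < ‖Matrix.toEuclideanLin Aᵀ u‖) : A.rank = k := by
  rw [← Matrix.rank_transpose, ← finrank_range_toEuclideanLin, LinearMap.finrank_range_of_inj]
  · simp
  refine (injective_iff_map_eq_zero _).2 fun u hu => ?_
  by_contra hu0
  have h1 := h (‖u‖⁻¹ • u) (by rw [norm_smul, norm_inv, norm_norm,
    inv_mul_cancel₀ (norm_ne_zero_iff.2 hu0)])
  simp [hu] at h1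

/-- Equal ranks force equal kernels, and `1 - (BM)⁺BM` maps into the kernel of `BM`. -/
theorem mul_pinv_mul_eq_of_rank_eq {k m n : ℕ} (B : Matrix (Fin k) (Fin m) ℝ)
    (M : Matrix (Fin m) (Fin n) ℝ) (h : (B * M).rank = M.rank) :
    M * (pinv (B * M) * (B * M)) = M := by
  have hker : LinearMap.ker M.mulVecLin = LinearMap.ker (B * M).mulVecLin := by
    refine Submodule.eq_of_le_of_finrank_eq (fun x hx => ?_) ?_
    · rw [LinearMap.mem_ker, Matrix.mulVecLin_apply] at hx ⊢
      rw [← Matrix.mulVec_mulVec, hx, Matrix.mulVec_zero]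
    · have h1 := LinearMap.finrank_range_add_finrank_ker M.mulVecLin
      have h2 := LinearMap.finrank_range_add_finrank_ker (B * M).mulVecLin
      unfold Matrix.rank at h
      omega
  have hz : ∀ x, M *ᵥ ((pinv (B * M) * (B * M) - 1) *ᵥ x) = 0 := fun x => by
    have : (pinv (B * M) * (B * M) - 1) *ᵥ x ∈ LinearMap.ker (B * M).mulVecLin := by
      rw [LinearMap.mem_ker, Matrix.mulVecLin_apply, Matrix.mulVec_mulVec, Matrix.mul_sub,
        ← Matrix.mul_assoc, (pinv_spec (B * M)).mul_mul_self, Matrix.mul_one, sub_self,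
        Matrix.zero_mulVec]
    rwa [← hker] at this
  have h0 : M * (pinv (B * M) * (B * M) - 1) = 0 := Matrix.ext_of_mulVec_single fun j => by
    rw [← Matrix.mulVec_mulVec, hz, Matrix.zero_mulVec]
  rwa [Matrix.mul_sub, Matrix.mul_one, sub_eq_zero] at h0

/-! ### From Gaussian matrices to the stated bounds -/

theorem IsGaussianMatrix.transpose {Ω : Type*} [MeasurableSpace Ω] {P : Measure Ω} {k l : ℕ}
    {a σ : ℝ} {X : Ω → Matrix (Fin k) (Fin l) ℝ} (h : IsGaussianMatrix P a σ X) :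
    IsGaussianMatrix P a σ (fun ω => (X ω)ᵀ) where
  hasLaw i j := h.hasLaw j i
  indep := h.indep.precomp (g := Prod.swap) Prod.swap_injective

/-- The normalized rows `e 0, e 1, …` of a Gaussian matrix form a standard Gaussian vector. -/
theorem IsGaussianMatrix.hasLaw_stdGaussian {Ω : Type*} [MeasurableSpace Ω] {P : Measure Ω}
    [IsProbabilityMeasure P] {k r m : ℕ} {a σ : ℝ} (hσ : 0 < σ)
    {X : Ω → Matrix (Fin r) (Fin m) ℝ} (h : IsGaussianMatrix P a σ X) {e : Fin k → Fin r}
    (he : e.Injective) :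
    HasLaw (fun ω => WithLp.toLp 2 fun p : Fin k × Fin m => σ⁻¹ * (X ω (e p.1) p.2 - a))
      (stdGaussian (EuclideanSpace ℝ (Fin k × Fin m))) P := by
  have hinj : Function.Injective fun p : Fin k × Fin m => (e p.1, p.2) := fun p q hpq => by
    simp only [Prod.mk.injEq] at hpq
    exact Prod.ext (he hpq.1) hpq.2
  have hlaw (p : Fin k × Fin m) :
      HasLaw (fun ω => σ⁻¹ * (X ω (e p.1) p.2 - a)) (gaussianReal 0 1) P := by
    have h1 := gaussianReal_const_mul (gaussianReal_sub_const (h.hasLaw (e p.1) p.2) a) σ⁻¹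
    convert h1 using 1
    rw [sub_self, mul_zero]
    congr 1
    ext
    simp only [NNReal.coe_mul, NNReal.coe_mk, Real.coe_toNNReal _ (sq_nonneg σ), NNReal.coe_one]
    field_simp
  have hind : iIndepFun (fun (p : Fin k × Fin m) ω => σ⁻¹ * (X ω (e p.1) p.2 - a)) P :=
    (h.indep.precomp hinj).comp (fun _ x => σ⁻¹ * (x - a)) fun _ => by fun_prop
  have hpi := hind.hasLaw_pi hlaw
  rw [← map_pi_eq_stdGaussian]
  exact HasLaw.fun_comp ⟨by fun_prop, rfl⟩ hpi

theorem toEuclideanLin_transpose_submatrix {k r m n : ℕ} (G : Matrix (Fin r) (Fin m) ℝ)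
    (M : Matrix (Fin m) (Fin n) ℝ) (e : Fin k → Fin r) (u : EuclideanSpace ℝ (Fin k)) :
    Matrix.toEuclideanLin ((G * M).submatrix e id)ᵀ u = Matrix.toEuclideanLin Mᵀ
      (rowComb k m u (WithLp.toLp 2 fun p => G (e p.1) p.2)) := by
  have h1 : ((G * M).submatrix e id)ᵀ = Mᵀ * (G.submatrix e id)ᵀ := by
    rw [← Matrix.transpose_mul]; rfl
  rw [h1, toEuclideanLin_mul_apply]
  congr 1
  ext j
  simp [Matrix.toLpLin_apply, Matrix.mulVec, dotProduct, mul_comm]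

/-- If `r ≤ rank M`, all rows are kept. Otherwise the first `rank M` rows, once independent, already
span the row space of `M`. -/
theorem exists_rows_of_min_rank {m n : ℕ} (r : ℕ) (M : Matrix (Fin m) (Fin n) ℝ) :
    ∃ k, min r M.rank = k ∧ ∃ e : Fin k → Fin r, e.Injective ∧ ∀ G : Matrix (Fin r) (Fin m) ℝ,
      ((G * M).submatrix e id).rank = k →
      G * M * (pinv ((G * M).submatrix e id) * (G * M).submatrix e id) = G * M := by
  rcases le_total r M.rank with h | h
  · refine ⟨r, min_eq_left h, id, Function.injective_id, fun G _ => ?_⟩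
    rw [Matrix.submatrix_id_id, ← Matrix.mul_assoc, (pinv_spec _).mul_mul_self]
  · refine ⟨M.rank, min_eq_right h, Fin.castLE h, Fin.castLE_injective h, fun G hG => ?_⟩
    have h1 : (G * M).submatrix (Fin.castLE h) id = G.submatrix (Fin.castLE h) id * M := rfl
    rw [h1] at hG ⊢
    rw [Matrix.mul_assoc G, mul_pinv_mul_eq_of_rank_eq _ _ hG]

theorem IsGaussianMatrix.one_div_norm_pinv_mul_le {Ω : Type*} [MeasurableSpace Ω] {P : Measure Ω}
    [IsProbabilityMeasure P] {m n r : ℕ} (hr : 0 < r) {a σ : ℝ} (hσ : 0 < σ)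
    {M : Matrix (Fin m) (Fin n) ℝ} (hM : M ≠ 0)
    {X : Ω → Matrix (Fin r) (Fin m) ℝ} (hX : IsGaussianMatrix P a σ X)
    (U : Matrix (Fin r) (Fin m) ℝ) {y : ℝ} (hy : 0 ≤ y) :
    P.real {ω | 1 / ‖pinv ((X ω + U) * M)‖ ≤ y} ≤
      2.35 * y * √(min r M.rank : ℕ) * ‖pinv M‖ / σ := by
  obtain ⟨k, hkdef, e, he, hrows⟩ := exists_rows_of_min_rank r M
  have hk : 0 < min r M.rank := lt_min hr (Nat.pos_of_ne_zero (rank_ne_zero_of_ne_zero hM))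
  rw [hkdef] at hk ⊢
  set δ := ‖pinv M‖⁻¹ with hδdef
  have hδ : 0 < δ := inv_pos.2 (norm_pos_iff.2 (pinv_ne_zero hM))
  set Z : Ω → EuclideanSpace ℝ (Fin k × Fin m) :=
    fun ω => WithLp.toLp 2 fun p => σ⁻¹ * (X ω (e p.1) p.2 - a) with hZ
  have hlaw : HasLaw Z (stdGaussian _) P := hX.hasLaw_stdGaussian hσ he
  -- The mean and the shift merge into one deterministic matrix, on which the bound does not depend.
  set B : EuclideanSpace ℝ (Fin k × Fin m) := WithLp.toLp 2 fun p => a + U (e p.1) p.2 with hB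
  have hBZ (ω : Ω) : B + σ • Z ω = WithLp.toLp 2 fun p => (X ω + U) (e p.1) p.2 := by
    ext p
    simp only [hB, hZ, PiLp.add_apply, PiLp.smul_apply, smul_eq_mul, Matrix.add_apply]
    field_simp
    ring
  set S : Set (EuclideanSpace ℝ (Fin k × Fin m)) :=
    {z | ∃ u, ‖u‖ = 1 ∧ ‖Matrix.toEuclideanLin Mᵀ (rowComb k m u (B + σ • z))‖ ≤ y} with hS
  have hbound : stdGaussian _ S ≤ ENNReal.ofReal (2.35 * y * √k / (σ * δ)) :=
    stdGaussian_exists_norm_rowComb_le _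
      (by rw [finrank_range_toEuclideanLin, Matrix.rank_transpose, ← hkdef]
          exact min_le_right _ _) hδ
      (norm_le_of_mem_range_transpose hM) B hσ hy
  have hsub : {ω | 1 / ‖pinv ((X ω + U) * M)‖ ≤ y} ⊆ Z ⁻¹' S := by
    intro ω hω
    rw [Set.mem_ofPred_eq] at hω
    by_contra hnot
    set A := ((X ω + U) * M).submatrix e id with hA
    have hgt : ∀ u, ‖u‖ = 1 → y < ‖Matrix.toEuclideanLin Aᵀ u‖ := fun u hu => by
      rw [hA, toEuclideanLin_transpose_submatrix, ← hBZ]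
      by_contra! hle
      exact hnot ⟨u, hu, hle⟩
    have hrank : A.rank = k := rank_eq_of_forall_norm_pos fun u hu => hy.trans_lt (hgt u hu)
    have hle : ‖pinv ((X ω + U) * M)‖ ≤ ‖pinv A‖ :=
      norm_pinv_le_norm_pinv_submatrix ((X ω + U) * M) he (hrows (X ω + U) hrank)
    have hlt := mul_norm_pinv_lt_one hk hy hgt
    -- Since `1 / ‖0⁺‖ = 0`, the case `GM = 0` lies in the event for every `y ≥ 0`; here it is
    -- excluded because `A` has rank `k > 0`.
    have hne : (X ω + U) * M ≠ 0 := fun h0 => by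
      rw [hA, h0, Matrix.submatrix_zero] at hrank
      simp only [Pi.zero_apply, Matrix.rank_zero] at hrank
      omega
    rw [div_le_iff₀ (norm_pos_iff.2 (pinv_ne_zero hne))] at hω
    have := mul_le_mul_of_nonneg_left hle hy
    linarith
  have hP : P {ω | 1 / ‖pinv ((X ω + U) * M)‖ ≤ y} ≤
      ENNReal.ofReal (2.35 * y * √k / (σ * δ)) :=
    -- This inequality for the push-forward holds without measurability of `S`.
    (measure_mono hsub).trans <| (Measure.le_map_apply hlaw.aemeasurable S).trans <| by
      rw [hlaw.map_eq]; exact hbound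
  refine (ENNReal.toReal_mono ENNReal.ofReal_ne_top hP).trans (le_of_eq ?_)
  rw [ENNReal.toReal_ofReal (by positivity), hδdef]
  field_simp

theorem IsGaussianMatrix.one_div_norm_pinv_mul_le' {Ω : Type*} [MeasurableSpace Ω]
    {P : Measure Ω} [IsProbabilityMeasure P] {m n r : ℕ} (hr : 0 < r) {a σ : ℝ} (hσ : 0 < σ)
    {M : Matrix (Fin m) (Fin n) ℝ} (hM : M ≠ 0)
    {X : Ω → Matrix (Fin n) (Fin r) ℝ} (hX : IsGaussianMatrix P a σ X)
    (V : Matrix (Fin n) (Fin r) ℝ) {y : ℝ} (hy : 0 ≤ y) :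
    P.real {ω | 1 / ‖pinv (M * (X ω + V))‖ ≤ y} ≤
      2.35 * y * √(min r M.rank : ℕ) * ‖pinv M‖ / σ := by
  have hMt : Mᵀ ≠ 0 := fun h => hM (by simpa using h)
  have h := hX.transpose.one_div_norm_pinv_mul_le hr hσ hMt Vᵀ hy
  simp_rw [← Matrix.transpose_add, ← Matrix.transpose_mul, norm_pinv_transpose,
    Matrix.rank_transpose] at h
  exact h

theorem measureReal_sigmaMin_le {Ω : Type*} [MeasurableSpace Ω] (P : Measure Ω)
    [IsProbabilityMeasure P] {k l : ℕ} (Y : Ω → Matrix (Fin k) (Fin l) ℝ) (y : ℝ) :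
    P.real {ω | sigmaMin (Y ω) ≤ y} ≤ P.real {ω | 1 / ‖pinv (Y ω)‖ ≤ y} :=
  measureReal_mono fun ω (hω : sigmaMin (Y ω) ≤ y) =>
    (one_div_norm_pinv_le_sigmaMin (Y ω)).trans hω

/-- Apply the small-ball bound at `y = 1 / (x * c)`. -/
theorem measureReal_le_norm_pinv_le {Ω : Type*} [MeasurableSpace Ω] {P : Measure Ω}
    [IsProbabilityMeasure P] {k l : ℕ} {Y : Ω → Matrix (Fin k) (Fin l) ℝ} {c : ℝ} (hc : 0 < c)
    (h : ∀ y, 0 ≤ y → P.real {ω | 1 / ‖pinv (Y ω)‖ ≤ y} ≤ y * c) {x : ℝ} (hx : 0 < x) :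
    P.real {ω | x * c ≤ ‖pinv (Y ω)‖} ≤ 1 / x := by
  refine (measureReal_mono fun ω (hω : x * c ≤ ‖pinv (Y ω)‖) => ?_).trans
    ((h (1 / (x * c)) (by positivity)).trans (le_of_eq (by field_simp)))
  exact one_div_le_one_div_of_le (by positivity) hω

theorem mainTheorem1 {Ω : Type*} [MeasurableSpace Ω] (P : Measure Ω) [IsProbabilityMeasure P]
    (m n r : ℕ) (hr : 0 < r) (a σ : ℝ) (hσ : 0 < σ)
    (M : Matrix (Fin m) (Fin n) ℝ) (hM : M ≠ 0)
    (G' : Ω → Matrix (Fin r) (Fin m) ℝ) (hG' : IsGaussianMatrix P a σ G')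
    (H' : Ω → Matrix (Fin n) (Fin r) ℝ) (hH' : IsGaussianMatrix P a σ H')
    (U : Matrix (Fin r) (Fin m) ℝ) (V : Matrix (Fin n) (Fin r) ℝ)
    (G : Ω → Matrix (Fin r) (Fin m) ℝ) (hG : ∀ ω, G ω = G' ω + U)
    (H : Ω → Matrix (Fin n) (Fin r) ℝ) (hH : ∀ ω, H ω = H' ω + V) :
    (∀ y : ℝ, 0 ≤ y →
      P.real {ω | 1 / ‖pinv (G ω * M)‖ ≤ y} ≤
          2.35 * y * √(min r M.rank : ℕ) * ‖pinv M‖ / σ ∧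
      P.real {ω | 1 / ‖pinv (M * H ω)‖ ≤ y} ≤
          2.35 * y * √(min r M.rank : ℕ) * ‖pinv M‖ / σ ∧
      P.real {ω | sigmaMin (G ω * M) ≤ y} ≤
          2.35 * y * √(min r M.rank : ℕ) * ‖pinv M‖ / σ ∧
      P.real {ω | sigmaMin (M * H ω) ≤ y} ≤
          2.35 * y * √(min r M.rank : ℕ) * ‖pinv M‖ / σ) ∧
    (∀ x : ℝ, 0 < x →
      P.real {ω | 2.35 * x * √(min r M.rank : ℕ) * ‖pinv M‖ / σ ≤ ‖pinv (G ω * M)‖} ≤ 1 / x ∧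
      P.real {ω | 2.35 * x * √(min r M.rank : ℕ) * ‖pinv M‖ / σ ≤ ‖pinv (M * H ω)‖} ≤ 1 / x) := by
  obtain rfl : G = fun ω => G' ω + U := funext hG
  obtain rfl : H = fun ω => H' ω + V := funext hH
  have hleft := fun y (hy : 0 ≤ y) => hG'.one_div_norm_pinv_mul_le hr hσ hM U hy
  have hright := fun y (hy : 0 ≤ y) => hH'.one_div_norm_pinv_mul_le' hr hσ hM V hy
  refine ⟨fun y hy => ⟨hleft y hy, hright y hy,
    (measureReal_sigmaMin_le P _ y).trans (hleft y hy),
    (measureReal_sigmaMin_le P _ y).trans (hright y hy)⟩, fun x hx => ?_⟩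
  set c := 2.35 * √(min r M.rank : ℕ) * ‖pinv M‖ / σ with hc
  have hk : 0 < min r M.rank := lt_min hr (Nat.pos_of_ne_zero (rank_ne_zero_of_ne_zero hM))
  have hM' : 0 < ‖pinv M‖ := norm_pos_iff.2 (pinv_ne_zero hM)
  have hc0 : 0 < c := by
    have : (0 : ℝ) < (min r M.rank : ℕ) := Nat.cast_pos.2 hk
    positivity
  have hcy (y : ℝ) : 2.35 * y * √(min r M.rank : ℕ) * ‖pinv M‖ / σ = y * c := by
    rw [hc]; ring
  simp only [hcy] at hleft hright ⊢
  exact ⟨measureReal_le_norm_pinv_le hc0 hleft hx, measureReal_le_norm_pinv_le hc0 hright hx⟩
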